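/- Let $p$ be an odd prime, let $m\ge 2$ and $0\le s\le m$ be integers with $m+s\ge 3$, and let $q=p^m$. Assume that either $p\equiv 1\pmod 4$, or $p\equiv 3\pmod 4$ and $m$ is even. Let $\zeta_p=e^{2\pi i/p}$, let $\mathrm{Tr}$ denote the trace from $\mathbb F_q$ to $\mathbb F_p$, and for $f:\mathbb F_q\to\mathbb F_p$ put $$W_f(\beta)=\sum_{x\in\mathbb F_q}\zeta_p^{f(x)-\mathrm{Tr}(\beta x)}\qquad(\beta\in\mathbb F_q).$$ Let $f:\mathbb F_q\to\mathbb F_p$ with $f(0)=0$ be a weakly regular $s$-plateaued function; that is, $|W_f(\beta)|^2\in\{0,p^{m+s}\}$ for all $\beta\in\mathbb F_q$, and there are a complex number $u$ with $|u|=1$ (independent of $\beta$) and a function $f^*:\mathbb F_q\to\mathbb F_p$ with $f^*(\beta)=0$ whenever $|W_f(\beta)|^2\ne p^{m+s}$, such that $W_f(\beta)\in\{0,\,u\,p^{(m+s)/2}\zeta_p^{f^*(\beta)}\}$ for all $\beta\in\mathbb F_q$. Let $$\mathcal C_f^*=\left\{\bigl(af(x)+\mathrm{Tr}(bx)\bigr)_{x\in\mathbb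 F_q^*}:a\in\mathbb F_p,\ b\in\mathbb F_q\right\}\subseteq\mathbb F_p^{\,q-1},$$ and for a linear code $\mathcal C$ let $\mathcal C^\perp$ be its dual with respect to the standard inner product. Then there exists a linear code $\mathcal D$ over $\mathbb F_p$ of length $q-1$ and dimension $(q-1)/2$ that is self-dual, i.e. $\mathcal D=\mathcal D^\perp$, and satisfies $\mathcal D\subseteq(\mathcal C_f^*)^\perp$. -/

import Mathlib

namespace PlateauedCode

noncomputable section

/-- The Walsh transform `W_f(β) = ∑_x ζ_p ^ (f(x) - Tr(βx))` of a function `f : F → 𝔽_p` on a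
finite extension `F` of `𝔽_p`; here `ZMod.stdAddChar a = exp(2πi a / p) = ζ_p ^ a`. -/
def walsh {p : ℕ} [Fact p.Prime] {F : Type*} [Field F] [Fintype F] [Algebra (ZMod p) F]
    (f : F → ZMod p) (β : F) : ℂ :=
  ∑ x : F, (ZMod.stdAddChar (f x - Algebra.trace (ZMod p) F (β * x)) : ℂ)

/-- `f` is `s`-plateaued on the field with `p ^ m` elements: `0 ≤ s ≤ m`, and `|W_f(β)|²` is
`0` or `p ^ (m + s)` for every `β`. -/
def IsPlateaued {p : ℕ} [Fact p.Prime] {F : Type*} [Field F] [Fintype F] [Algebra (ZMod p) F]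
    (m s : ℕ) (f : F → ZMod p) : Prop :=
  s ≤ m ∧ ∀ β : F, ‖walsh f β‖ ^ 2 = 0 ∨ ‖walsh f β‖ ^ 2 = (p : ℝ) ^ (m + s)

/-- The Walsh support `S_f = {β : |W_f(β)|² = p ^ (m + s)}`. -/
def walshSupport {p : ℕ} [Fact p.Prime] {F : Type*} [Field F] [Fintype F] [Algebra (ZMod p) F]
    (m s : ℕ) (f : F → ZMod p) : Set F :=
  {β : F | ‖walsh f β‖ ^ 2 = (p : ℝ) ^ (m + s)}

/-- `f` is weakly regular `s`-plateaued: it is `s`-plateaued and there are `u ∈ ℂ` with `|u| = 1`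
and `f* : F → 𝔽_p`, zero outside the Walsh support, such that
`W_f(β) ∈ {0, u p^((m+s)/2) ζ_p^(f*(β))}` for every `β`. -/
def IsWeaklyRegularPlateaued {p : ℕ} [Fact p.Prime] {F : Type*} [Field F] [Fintype F]
    [Algebra (ZMod p) F] (m s : ℕ) (f : F → ZMod p) : Prop :=
  IsPlateaued m s f ∧
    ∃ (u : ℂ) (fstar : F → ZMod p), ‖u‖ = 1 ∧
      (∀ β : F, β ∉ walshSupport m s f → fstar β = 0) ∧
      ∀ β : F, walsh f β = 0 ∨
        walsh f β = u * (((p : ℝ) ^ (((m : ℝ) + (s : ℝ)) / 2) : ℝ) : ℂ) *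
          ZMod.stdAddChar (fstar β)

/-- The punctured code `C_f^* = {(a f(x) + Tr(b x))_{x ∈ F^*} : a ∈ 𝔽_p, b ∈ F}`, with
coordinates indexed by `F^*`. -/
def codeStar {p : ℕ} [Fact p.Prime] {F : Type*} [Field F] [Algebra (ZMod p) F]
    (f : F → ZMod p) : Submodule (ZMod p) (Fˣ → ZMod p) where
  carrier := {c | ∃ (a : ZMod p) (b : F),
    c = fun x : Fˣ => a * f (x : F) + Algebra.trace (ZMod p) F (b * (x : F))}
  zero_mem' := ⟨0, 0, by ext x; simp⟩
  add_mem' := by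
    rintro _ _ ⟨a, b, rfl⟩ ⟨a', b', rfl⟩
    refine ⟨a + a', b + b', ?_⟩
    ext x
    simp only [Pi.add_apply, add_mul, map_add]
    ring
  smul_mem' := by
    rintro r _ ⟨a, b, rfl⟩
    refine ⟨r * a, r • b, ?_⟩
    ext x
    simp only [Pi.smul_apply, smul_eq_mul, smul_mul_assoc, map_smul]
    ring

/-- The dual code with respect to the standard inner product. -/
def dualCode {K ι : Type*} [Field K] [Fintype ι] (C : Submodule K (ι → K)) :
    Submodule K (ι → K) where
  carrier := {u | ∀ v ∈ C, u ⬝ᵥ v = 0}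
  zero_mem' := fun v _ => zero_dotProduct v
  add_mem' := fun {u w} hu hw v hv => by rw [add_dotProduct, hu v hv, hw v hv, add_zero]
  smul_mem' := fun r u hu v hv => by rw [smul_dotProduct, hu v hv, smul_zero]

/-- A linear code is self-dual if it equals its dual code. -/
def IsSelfDual {K ι : Type*} [Field K] [Fintype ι] (C : Submodule K (ι → K)) : Prop :=
  C = dualCode C

/-- `C` is an `[n, k]` linear code: length `n` and dimension `k`. -/
def HasParameters {K ι : Type*} [Field K] [Fintype ι] (C : Submodule K (ι → K)) (n k : ℕ) :
    Prop :=
  Fintype.card ι = n ∧ Module.finrank K C = k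

end

end PlateauedCode

/-!
The code `C = codeStar f` is self-orthogonal, and under the congruence hypotheses every
self-orthogonal code of length `p ^ m - 1` extends to a self-dual one.

*Self-orthogonality.* Let `g : F → 𝔽_p` have an exponential sum `W = ∑ ζ ^ g(x)` with
`|W|² ∈ {0, p ^ k}`, where `k ≥ 3`. In `ℤ[ζ]` put `π = ζ - 1`; this is a prime with
`π ^ (p - 1) ∼ p`, so that `π ^ 6 ∣ W * conj W` and hence `π ^ 3` divides `W` or `conj W`.
Expanding `ζ ^ j = (1 + π) ^ j` modulo `π ^ 3`, with values of `g` taken in `{0, …, p - 1}`, gives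
`W ≡ |F| + (∑ g) π + (∑ (g choose 2)) π ^ 2`, and as `p ^ 2 ∣ |F|` both `∑ g` and
`∑ (g choose 2)` vanish modulo `p`. Therefore `∑ g(x)² = 0` in `𝔽_p`
(`sum_sq_eq_zero_of_norm_sq_expSum`). Applied to `g(x) = f(x) - Tr(β x)` for all `β`, including
`0` and `-β`, this yields `∑ f² = 0`, `∑ Tr(β x)² = 0` and `∑ f(x) Tr(β x) = 0`: every word of `C`
is isotropic, and by polarization `C ⊆ C^⊥`. Only the absolute values of the Walsh transform enter.

*Extension.* If `D₀` is any self-dual code and `C ⊆ C^⊥`, then `(D₀ ∩ C^⊥) + C` is self-dual by the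
modular law (`isSelfDual_inf_dualCode_sup`). A self-dual code of even length `2k` is the graph of a
`k × k` matrix `A` with `Aᵀ A = -1`: a scalar matrix if `-1` is a square, and the block matrix
`[[a, -b], [b, a]]` with `a² + b² = -1` if `k` is even.
-/

open PlateauedCode

/-! ### Self-dual codes -/

theorem mem_dualCode {K ι : Type*} [Field K] [Fintype ι] {C : Submodule K (ι → K)} {u : ι → K} :
    u ∈ dualCode C ↔ ∀ v ∈ C, u ⬝ᵥ v = 0 := Iff.rfl

theorem dualCode_eq_orthogonal {K ι : Type*} [Field K] [Fintype ι] (C : Submodule K (ι → K)) :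
    dualCode C = LinearMap.BilinForm.orthogonal (dotProductBilin K K) C := by
  ext u
  rw [LinearMap.BilinForm.mem_orthogonal_iff, mem_dualCode]
  refine forall₂_congr fun v _ => ?_
  rw [dotProduct_comm]
  rfl

theorem dotProductBilin_isRefl (K ι : Type*) [Field K] [Fintype ι] :
    LinearMap.BilinForm.IsRefl (dotProductBilin K K : LinearMap.BilinForm K (ι → K)) := by
  intro u v h
  rw [dotProductBilin_apply_apply] at h ⊢
  rwa [dotProduct_comm]

theorem dotProductBilin_nondegenerate (K ι : Type*) [Field K] [Fintype ι] :
    LinearMap.BilinForm.Nondegenerate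
      (dotProductBilin K K : LinearMap.BilinForm K (ι → K)) := by
  refine (dotProductBilin_isRefl K ι).nondegenerate_iff_separatingLeft.2 fun u hu => ?_
  exact dotProduct_eq_zero u fun v => hu v

theorem dualCode_dualCode {K ι : Type*} [Field K] [Fintype ι] (C : Submodule K (ι → K)) :
    dualCode (dualCode C) = C := by
  rw [dualCode_eq_orthogonal, dualCode_eq_orthogonal,
    LinearMap.BilinForm.orthogonal_orthogonal (dotProductBilin_nondegenerate K ι)
      (dotProductBilin_isRefl K ι)]

theorem finrank_dualCode {K ι : Type*} [Field K] [Fintype ι] (C : Submodule K (ι → K)) :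
    Module.finrank K (dualCode C) = Fintype.card ι - Module.finrank K C := by
  rw [dualCode_eq_orthogonal,
    LinearMap.BilinForm.finrank_orthogonal (dotProductBilin_nondegenerate K ι),
    Module.finrank_fintype_fun_eq_card]

theorem dualCode_anti {K ι : Type*} [Field K] [Fintype ι] {C D : Submodule K (ι → K)}
    (h : C ≤ D) : dualCode D ≤ dualCode C := fun _ hu v hv => hu v (h hv)

theorem dualCode_sup {K ι : Type*} [Field K] [Fintype ι] (C D : Submodule K (ι → K)) :
    dualCode (C ⊔ D) = dualCode C ⊓ dualCode D := by
  apply le_antisymm (le_inf (dualCode_anti le_sup_left) (dualCode_anti le_sup_right))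
  rintro u ⟨hC, hD⟩ v hv
  obtain ⟨c, hc, d, hd, rfl⟩ := Submodule.mem_sup.1 hv
  rw [dotProduct_add, hC c hc, hD d hd, add_zero]

theorem dualCode_inf {K ι : Type*} [Field K] [Fintype ι] (C D : Submodule K (ι → K)) :
    dualCode (C ⊓ D) = dualCode C ⊔ dualCode D := by
  rw [← dualCode_dualCode (dualCode C ⊔ dualCode D), dualCode_sup, dualCode_dualCode,
    dualCode_dualCode]

/-- A self-orthogonal code `C` lies in the self-dual code `(D₀ ∩ C^⊥) + C`, whenever there is some
self-dual code `D₀` of the same length. -/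
theorem isSelfDual_inf_dualCode_sup {K ι : Type*} [Field K] [Fintype ι]
    {C D₀ : Submodule K (ι → K)} (hC : C ≤ dualCode C) (hD₀ : IsSelfDual D₀) :
    IsSelfDual (D₀ ⊓ dualCode C ⊔ C) := by
  unfold IsSelfDual at hD₀ ⊢
  rw [dualCode_sup, dualCode_inf, ← hD₀, dualCode_dualCode, sup_comm, sup_comm D₀ C,
    sup_inf_assoc_of_le D₀ hC]

theorem finrank_eq_of_isSelfDual {K ι : Type*} [Field K] [Fintype ι] {D : Submodule K (ι → K)}
    (hD : IsSelfDual D) (heven : Even (Fintype.card ι)) :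
    Module.finrank K D = Fintype.card ι / 2 := by
  have h := finrank_dualCode D
  rw [← show D = dualCode D from hD] at h
  have hle := Submodule.finrank_le D
  rw [Module.finrank_fintype_fun_eq_card] at hle
  obtain ⟨k, hk⟩ := heven
  omega

/-- The graph of a matrix `A` with `Aᵀ A = -1` is a self-dual code. -/
theorem exists_isSelfDual_of_transpose_mul_self_eq_neg_one {K ι κ : Type*} [Field K] [Fintype ι]
    [Fintype κ] [DecidableEq κ] (e : κ ⊕ κ ≃ ι) (A : Matrix κ κ K)
    (hA : A.transpose * A = -1) : ∃ D : Submodule K (ι → K), IsSelfDual D := by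
  have hA' : A * A.transpose = -1 := by
    have h : -A.transpose * A = 1 := by rw [neg_mul, hA, neg_neg]
    rw [mul_eq_one_comm, mul_neg] at h
    rw [← h, neg_neg]
  have hdot (u v : ι → K) : u ⬝ᵥ v = (fun k => u (e (.inl k))) ⬝ᵥ (fun k => v (e (.inl k))) +
      (fun k => u (e (.inr k))) ⬝ᵥ (fun k => v (e (.inr k))) := by
    simp only [dotProduct]
    rw [← e.sum_comp, Fintype.sum_sum_type]
  let D : Submodule K (ι → K) :=
    { carrier := {u | (fun k => u (e (.inr k))) = A.mulVec (fun k => u (e (.inl k)))}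
      zero_mem' := (A.mulVec_zero).symm
      add_mem' := fun {u v} hu hv => by
        have := congrArg₂ (· + ·) hu hv
        simp only [← Matrix.mulVec_add] at this
        exact this
      smul_mem' := fun r u hu => by
        have := congrArg (r • ·) hu
        simp only [← Matrix.mulVec_smul] at this
        exact this }
  refine ⟨D, le_antisymm (fun u hu v hv => ?_) fun u hu => ?_⟩
  · change _ = _ at hu hv
    rw [hdot, hu, hv, Matrix.dotProduct_mulVec, ← Matrix.mulVec_transpose, Matrix.mulVec_mulVec,
      hA, Matrix.neg_mulVec, Matrix.one_mulVec, neg_dotProduct, add_neg_cancel]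
  · -- Testing `u = (u₁, u₂)` against the words `(x, A x)` gives `u₁ + Aᵀ u₂ = 0`.
    have h : (fun k => u (e (.inl k))) + A.transpose.mulVec (fun k => u (e (.inr k))) = 0 := by
      refine dotProduct_eq_zero _ fun x => ?_
      have hx := hu (fun i => Sum.elim x (A.mulVec x) (e.symm i)) (by
        change (fun k => _) = A.mulVec (fun k => _)
        simp)
      rw [hdot] at hx
      simp only [Equiv.symm_apply_apply, Sum.elim_inl, Sum.elim_inr] at hx
      rw [add_dotProduct, Matrix.mulVec_transpose, ← Matrix.dotProduct_mulVec]
      exact hx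
    change _ = _
    rw [eq_neg_of_add_eq_zero_left h, Matrix.mulVec_neg, Matrix.mulVec_mulVec, hA',
      Matrix.neg_mulVec, Matrix.one_mulVec, neg_neg]

theorem exists_isSelfDual_of_isSquare_neg_one {K ι : Type*} [Field K] [Fintype ι]
    (hK : IsSquare (-1 : K)) (hι : Even (Fintype.card ι)) :
    ∃ D : Submodule K (ι → K), IsSelfDual D := by
  obtain ⟨k, hk⟩ := hι
  obtain ⟨a, ha⟩ := hK
  have e : Fin k ⊕ Fin k ≃ ι := Fintype.equivOfCardEq (by simp [hk])
  refine exists_isSelfDual_of_transpose_mul_self_eq_neg_one e (Matrix.scalar _ a) ?_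
  simp [← ha, ← Matrix.diagonal_one, Matrix.diagonal_neg]

theorem exists_isSelfDual_of_four_dvd_card {p : ℕ} [Fact p.Prime] {ι : Type*} [Fintype ι]
    (hι : 4 ∣ Fintype.card ι) : ∃ D : Submodule (ZMod p) (ι → ZMod p), IsSelfDual D := by
  obtain ⟨k, hk⟩ := hι
  obtain ⟨a, b, hab⟩ := ZMod.sq_add_sq p (-1)
  have e : (Fin k ⊕ Fin k) ⊕ (Fin k ⊕ Fin k) ≃ ι :=
    Fintype.equivOfCardEq (by simp [hk]; ring)
  refine exists_isSelfDual_of_transpose_mul_self_eq_neg_one e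
    (Matrix.fromBlocks (Matrix.scalar _ a) (-Matrix.scalar _ b) (Matrix.scalar _ b)
      (Matrix.scalar _ a)) ?_
  rw [← Matrix.fromBlocks_one, Matrix.fromBlocks_neg, Matrix.fromBlocks_transpose,
    Matrix.fromBlocks_multiply]
  simp only [Matrix.scalar_apply, Matrix.transpose_neg, Matrix.diagonal_transpose, neg_mul,
    mul_neg, neg_neg, Matrix.diagonal_mul_diagonal, Matrix.diagonal_add]
  congr 1
  · rw [← Matrix.diagonal_one, Matrix.diagonal_neg]; congr 1; ext; simp [← hab]; ring
  · simp [mul_comm]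
  · simp [mul_comm]
  · rw [← Matrix.diagonal_one, Matrix.diagonal_neg]; congr 1; ext; simp [← hab]; ring

/-! ### Exponential sums modulo the cube of `ζ - 1` -/

theorem pow_three_dvd_one_add_pow_sub {R : Type*} [CommRing R] (l : R) (k : ℕ) :
    l ^ 3 ∣ (1 + l) ^ k - (1 + k * l + k.choose 2 * l ^ 2) := by
  induction k with
  | zero => simp
  | succ k ih =>
    obtain ⟨c, hc⟩ := ih
    refine ⟨c * (1 + l) + k.choose 2, ?_⟩
    rw [pow_succ, eq_add_of_sub_eq hc, Nat.choose_succ_succ' k 1, Nat.choose_one_right]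
    push_cast
    ring

/-- If an element `l` of a domain behaves like `ζ_p - 1` and `l ^ 3` divides both the number of
terms and the sum of the powers `(1 + l) ^ k x`, then `p` divides `∑ k x` and `∑ (k x).choose 2`, the
coefficients of `l` and `l ^ 2` in the sum. -/
theorem dvd_sum_and_dvd_sum_choose_two {R ι : Type*} [CommRing R] [IsDomain R] [Fintype ι]
    {p : ℕ} {l : R} (hl : l ≠ 0) (hlp : l ^ 2 ∣ (p : R)) (hint : ∀ n : ℕ, l ∣ (n : R) → p ∣ n)
    (hcard : l ^ 3 ∣ (Fintype.card ι : R)) (k : ι → ℕ) (hk : l ^ 3 ∣ ∑ x, (1 + l) ^ k x) :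
    p ∣ ∑ x, k x ∧ p ∣ ∑ x, (k x).choose 2 := by
  have hexp : l ^ 3 ∣ ∑ x, (1 + l) ^ k x - (Fintype.card ι + ((∑ x, k x : ℕ) : R) * l +
      ((∑ x, (k x).choose 2 : ℕ) : R) * l ^ 2) := by
    have h := Finset.dvd_sum fun x (_ : x ∈ Finset.univ) => pow_three_dvd_one_add_pow_sub l (k x)
    simpa [Finset.sum_sub_distrib, Finset.sum_add_distrib, Finset.sum_mul] using h
  generalize ∑ x, k x = S at *
  generalize ∑ x, (k x).choose 2 = T at *
  have h2 : l ^ 2 ∣ (S : R) + T * l := by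
    have h3 : l * l ^ 2 ∣ l * ((S : R) + T * l) := by
      convert (hk.sub hexp).sub hcard using 1 <;> ring
    exact (mul_dvd_mul_iff_left hl).1 h3
  have hS : p ∣ S := hint S <|
    (dvd_add_left (Dvd.intro_left _ rfl)).1 ((dvd_pow_self l two_ne_zero).trans h2)
  refine ⟨hS, hint T ?_⟩
  have hS' : l ^ 2 ∣ (S : R) := hlp.trans (Nat.cast_dvd_cast hS)
  have h4 := (dvd_add_right hS').1 h2
  rw [mul_comm, sq] at h4
  exact (mul_dvd_mul_iff_left hl).1 h4

theorem sum_sq_eq_zero_of_dvd {ι : Type*} [Fintype ι] {p : ℕ} [NeZero p] (g : ι → ZMod p)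
    (h₁ : p ∣ ∑ x, (g x).val) (h₂ : p ∣ ∑ x, (g x).val.choose 2) : ∑ x, g x ^ 2 = 0 := by
  have hsq (k : ℕ) : k ^ 2 = 2 * k.choose 2 + k := by
    induction k with
    | zero => rfl
    | succ k ih =>
      rw [Nat.choose_succ_succ' k 1, Nat.choose_one_right]
      linarith
  have h : p ∣ ∑ x, (g x).val ^ 2 := by
    simp only [hsq, Finset.sum_add_distrib, ← Finset.mul_sum]
    exact (h₂.mul_left 2).add h₁
  simpa using (ZMod.natCast_eq_zero_iff _ p).2 h

theorem Prime.pow_dvd_or_pow_dvd_of_pow_two_mul_dvd {R : Type*} [CommRing R] [IsDomain R]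
    {l a b : R} (hl : Prime l) {n : ℕ} (h : l ^ (2 * n) ∣ a * b) : l ^ n ∣ a ∨ l ^ n ∣ b := by
  by_contra! hab
  have ha := lt_of_not_ge (mt pow_dvd_of_le_emultiplicity hab.1)
  have hb := lt_of_not_ge (mt pow_dvd_of_le_emultiplicity hab.2)
  have h' := le_emultiplicity_of_pow_dvd h
  rw [emultiplicity_mul hl] at h'
  lift emultiplicity l a to ℕ using ha.ne_top with i
  lift emultiplicity l b to ℕ using hb.ne_top with j
  norm_cast at *
  omega

/-- `CyclotomicField.isCyclotomicExtension`, restated for the canonical `ℚ`-algebra structure of a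
field of characteristic zero, which is the one that the theory of number fields uses. -/
theorem isCyclotomicExtension_cyclotomicField_rat (p : ℕ) [Fact p.Prime] :
    IsCyclotomicExtension {p} ℚ (CyclotomicField p ℚ) := by
  have : NeZero (p : ℚ) := ⟨by exact_mod_cast (Fact.out : p.Prime).ne_zero⟩
  convert! CyclotomicField.isCyclotomicExtension p ℚ

theorem exists_ringHom_stdAddChar_one (p : ℕ) [Fact p.Prime] :
    ∃ (ζ : CyclotomicField p ℚ) (φ : CyclotomicField p ℚ →+* ℂ), IsPrimitiveRoot ζ p ∧
      φ ζ = ZMod.stdAddChar (1 : ZMod p) := by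
  have hpos := (Fact.out : p.Prime).pos
  have := isCyclotomicExtension_cyclotomicField_rat p
  have hζ := IsCyclotomicExtension.zeta_spec p ℚ (CyclotomicField p ℚ)
  have hroot : ZMod.stdAddChar (1 : ZMod p) ∈ primitiveRoots p ℂ := by
    rw [mem_primitiveRoots hpos]
    convert! Complex.isPrimitiveRoot_exp p hpos.ne'
    simpa using ZMod.stdAddChar_coe (N := p) 1
  let E := hζ.embeddingsEquivPrimitiveRoots ℂ (Polynomial.cyclotomic.irreducible_rat hpos)
  refine ⟨_, (E.symm ⟨_, hroot⟩ : CyclotomicField p ℚ →ₐ[ℚ] ℂ), hζ, ?_⟩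
  exact congrArg Subtype.val (E.apply_symm_apply ⟨_, hroot⟩)

/-- If the exponential sum of `g` has absolute value `0` or `p ^ (k / 2)` with `k ≥ 3`, and `p ^ 2`
divides the number of terms, then `∑ g(x) ^ 2 = 0` in `𝔽_p`. -/
theorem sum_sq_eq_zero_of_norm_sq_expSum {ι : Type*} [Fintype ι] {p : ℕ} [Fact p.Prime]
    (hp : Odd p) (hcard : p ^ 2 ∣ Fintype.card ι) (g : ι → ZMod p) {k : ℕ} (hk : 3 ≤ k)
    (hg : ‖∑ x, (ZMod.stdAddChar (g x) : ℂ)‖ ^ 2 = 0 ∨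
      ‖∑ x, (ZMod.stdAddChar (g x) : ℂ)‖ ^ 2 = (p : ℝ) ^ k) :
    ∑ x, g x ^ 2 = 0 := by
  have hp3 : 3 ≤ p := by
    have := (Fact.out : p.Prime).two_le
    obtain ⟨r, rfl⟩ := hp
    omega
  have := isCyclotomicExtension_cyclotomicField_rat p
  obtain ⟨ζ, φ, hζ, hφ⟩ := exists_ringHom_stdAddChar_one p
  let O := NumberField.RingOfIntegers (CyclotomicField p ℚ)
  let l : O := hζ.toInteger - 1
  have hl : Prime l := hζ.zeta_sub_one_prime'
  have hlp : l ^ 2 ∣ (p : O) := (pow_dvd_pow l (by omega)).trans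
    (IsCyclotomicExtension.Rat.associated_zeta_sub_one_pow_prime p hζ).dvd
  have hint (n : ℕ) (hn : l ∣ (n : O)) : p ∣ n := by
    have := (IsCyclotomicExtension.Rat.zeta_sub_one_dvd_intCast_iff' p hζ (n := n)).1 (by simpa using hn)
    exact_mod_cast this
  have hcard' : l ^ 3 ∣ (Fintype.card ι : O) := by
    have h := (pow_dvd_pow_of_dvd hlp 2).trans (by exact_mod_cast Nat.cast_dvd_cast (α := O) hcard)
    rw [← pow_mul] at h
    exact (pow_dvd_pow l (by norm_num)).trans h
  let ψ : O →+* ℂ := φ.comp (algebraMap O (CyclotomicField p ℚ))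
  have hψ : Function.Injective ψ :=
    φ.injective.comp NumberField.RingOfIntegers.coe_injective
  have hψl : ψ (1 + l) = ZMod.stdAddChar (1 : ZMod p) := by
    rw [← hφ, add_sub_cancel]
    rfl
  let W (h : ι → ZMod p) : O := ∑ x, (1 + l) ^ (h x).val
  have hW (h : ι → ZMod p) : ψ (W h) = ∑ x, (ZMod.stdAddChar (h x) : ℂ) := by
    rw [map_sum]
    refine Finset.sum_congr rfl fun x _ => ?_
    rw [map_pow, hψl, ← AddChar.map_nsmul_eq_pow]
    simp
  -- `W (-g)` is the complex conjugate of `W g`.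
  have hprod : ψ (W g * W (-g)) = ((‖∑ x, (ZMod.stdAddChar (g x) : ℂ)‖ ^ 2 : ℝ) : ℂ) := by
    rw [map_mul, hW, hW]
    simp only [Pi.neg_apply, AddChar.map_neg_eq_conj]
    rw [← map_sum (starRingEnd ℂ), Complex.mul_conj, Complex.normSq_eq_norm_sq]
  have hdvd : l ^ (2 * 3) ∣ W g * W (-g) := by
    rcases hg with hg | hg <;> rw [hg] at hprod
    · have : W g * W (-g) = 0 := hψ (by rw [hprod]; simp)
      rw [this]
      exact dvd_zero _
    · have : W g * W (-g) = (p : O) ^ k := hψ (by rw [hprod, map_pow, map_natCast]; simp)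
      rw [this, pow_mul]
      exact (pow_dvd_pow_of_dvd hlp 3).trans (pow_dvd_pow _ hk)
  have key (h : ι → ZMod p) (hh : l ^ 3 ∣ W h) : ∑ x, h x ^ 2 = 0 := by
    obtain ⟨h₁, h₂⟩ := dvd_sum_and_dvd_sum_choose_two hl.ne_zero hlp hint hcard' _ hh
    exact sum_sq_eq_zero_of_dvd h h₁ h₂
  rcases hl.pow_dvd_or_pow_dvd_of_pow_two_mul_dvd hdvd with h | h
  · exact key g h
  · simpa using key (-g) h

/-! ### Self-orthogonality of the punctured code -/

/-- The words of `codeStar f` are restrictions of functions vanishing at `0`, so sums over `Fˣ` are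
sums over `F`. -/
theorem sum_units_eq_sum {F M : Type*} [Field F] [Fintype F] [DecidableEq F] [AddCommMonoid M]
    (h : F → M) (h0 : h 0 = 0) : ∑ x : Fˣ, h x = ∑ x : F, h x := by
  refine Finset.sum_of_injOn Units.val Units.val_injective.injOn (fun _ _ => Finset.mem_univ _)
    (fun x _ hx => ?_) fun _ _ => rfl
  by_contra hne
  have hx0 : x ≠ 0 := by
    rintro rfl
    exact hne h0
  exact hx ⟨Units.mk0 x hx0, Finset.mem_coe.2 (Finset.mem_univ _), rfl⟩

theorem codeStar_le_dualCode_of_isPlateaued {p m s : ℕ} [Fact p.Prime] (hp : Odd p) (hm : 2 ≤ m)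
    (hms : 3 ≤ m + s) {F : Type*} [Field F] [Fintype F] [DecidableEq F] [Algebra (ZMod p) F]
    (hF : Fintype.card F = p ^ m) {f : F → ZMod p} (hf0 : f 0 = 0) (hf : IsPlateaued m s f) :
    codeStar f ≤ dualCode (codeStar f) := by
  have h2 : (2 : ZMod p) ≠ 0 := by
    rw [Ne, ← Nat.cast_ofNat, ZMod.natCast_eq_zero_iff,
      Nat.prime_dvd_prime_iff_eq Fact.out Nat.prime_two]
    rintro rfl
    exact absurd hp (by decide)
  have hsq (β : F) : ∑ x, (f x - Algebra.trace (ZMod p) F (β * x)) ^ 2 = 0 :=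
    sum_sq_eq_zero_of_norm_sq_expSum hp (hF ▸ pow_dvd_pow p hm) _ hms (hf.2 β)
  have hff : ∑ x, f x ^ 2 = 0 := by simpa using hsq 0
  have hexp (β : F) : ∑ x, (f x - Algebra.trace (ZMod p) F (β * x)) ^ 2 = ∑ x, f x ^ 2 -
      2 * ∑ x, f x * Algebra.trace (ZMod p) F (β * x) +
      ∑ x, Algebra.trace (ZMod p) F (β * x) ^ 2 := by
    rw [Finset.mul_sum, ← Finset.sum_sub_distrib, ← Finset.sum_add_distrib]
    exact Finset.sum_congr rfl fun x _ => by ring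
  have hpos (β : F) := (hexp β).symm.trans (hsq β)
  have hneg (β : F) := (hexp (-β)).symm.trans (hsq (-β))
  simp only [neg_mul, map_neg, mul_neg, Finset.sum_neg_distrib, neg_sq, hff] at hpos hneg
  have htt (β : F) : ∑ x, Algebra.trace (ZMod p) F (β * x) ^ 2 = 0 :=
    (mul_eq_zero.1 (by linear_combination hpos β + hneg β)).resolve_left h2
  have hft (β : F) : ∑ x, f x * Algebra.trace (ZMod p) F (β * x) = 0 :=
    (mul_eq_zero.1 (by linear_combination htt β - hpos β)).resolve_left h2
  have hiso (c : Fˣ → ZMod p) (hc : c ∈ codeStar f) : c ⬝ᵥ c = 0 := by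
    obtain ⟨a, b, rfl⟩ := hc
    rw [dotProduct, sum_units_eq_sum
      (fun x => (a * f x + Algebra.trace (ZMod p) F (b * x)) *
        (a * f x + Algebra.trace (ZMod p) F (b * x))) (by simp [hf0])]
    calc _ = a ^ 2 * ∑ x, f x ^ 2 + 2 * a * ∑ x, f x * Algebra.trace (ZMod p) F (b * x) +
          ∑ x, Algebra.trace (ZMod p) F (b * x) ^ 2 := by
          rw [Finset.mul_sum, Finset.mul_sum, ← Finset.sum_add_distrib, ← Finset.sum_add_distrib]
          exact Finset.sum_congr rfl fun x _ => by ring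
      _ = 0 := by rw [hff, hft, htt]; ring
  intro u hu v hv
  have h := hiso (u + v) (add_mem hu hv)
  rw [add_dotProduct, dotProduct_add, dotProduct_add, hiso u hu, hiso v hv,
    dotProduct_comm v u] at h
  exact (mul_eq_zero.1 (by linear_combination h)).resolve_left h2

/-! ### The self-dual code -/

theorem mainTheorem8 (p m s : ℕ) [Fact p.Prime] (hp : Odd p) (hm : 2 ≤ m) (hms : 3 ≤ m + s)
    (hpm : p % 4 = 1 ∨ (p % 4 = 3 ∧ Even m))
    {F : Type*} [Field F] [Fintype F] [DecidableEq F] [Algebra (ZMod p) F]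
    (hF : Fintype.card F = p ^ m)
    (f : F → ZMod p) (hf0 : f 0 = 0) (hf : PlateauedCode.IsWeaklyRegularPlateaued m s f) :
    ∃ D : Submodule (ZMod p) (Fˣ → ZMod p),
      PlateauedCode.HasParameters D (p ^ m - 1) ((p ^ m - 1) / 2) ∧
      PlateauedCode.IsSelfDual D ∧
      D ≤ PlateauedCode.dualCode (PlateauedCode.codeStar f) := by
  have hcard : Fintype.card Fˣ = p ^ m - 1 := by rw [Fintype.card_units, hF]
  have heven : Even (Fintype.card Fˣ) := by
    rw [hcard]
    exact Nat.Odd.sub_odd hp.pow odd_one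
  obtain ⟨D₀, hD₀⟩ : ∃ D : Submodule (ZMod p) (Fˣ → ZMod p), IsSelfDual D := by
    rcases hpm with h | ⟨h, k, rfl⟩
    · exact exists_isSelfDual_of_isSquare_neg_one
        (ZMod.exists_sq_eq_neg_one_iff.2 (by omega)) heven
    · -- An even power of an odd number is `1` modulo `4`.
      refine exists_isSelfDual_of_four_dvd_card ?_
      rw [hcard]
      refine (Nat.modEq_iff_dvd' (Nat.one_le_pow _ _ (Fact.out : p.Prime).pos)).1 ?_
      have hpp : p * p ≡ 1 [MOD 4] := by rw [Nat.ModEq, Nat.mul_mod, h]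
      rw [pow_add, ← mul_pow]
      simpa using (hpp.pow k).symm
  have hD := isSelfDual_inf_dualCode_sup (codeStar_le_dualCode_of_isPlateaued hp hm hms hF hf0 hf.1) hD₀
  refine ⟨_, ⟨hcard, ?_⟩, hD, ?_⟩
  · rw [finrank_eq_of_isSelfDual hD heven, hcard]
  · conv_lhs => rw [show _ = dualCode _ from hD]
    exact dualCode_anti le_sup_right
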